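/- Let $\mathbf X$ be a category with all pullbacks, let $\mathcal M$ be a class of monomorphisms of $\mathbf X$ and let $\mathcal N$ be a class of arrows of $\mathbf X$. Sizes are measured in a universe $\mathcal U$ relative to which $\mathbf X$ is essentially small; every category has this property for a large enough $\mathcal U$. A class $\mathcal A$ of arrows is closed under $\mathcal B$-decomposition if $g\circ f\in\mathcal A$ and $g\in\mathcal B$ imply $f\in\mathcal A$, and closed under decomposition if it is closed under $\mathcal A$-decomposition. The pair $(\mathcal M,\mathcal N)$ is a preadhesive structure if both classes contain all isomorphisms, are closed under composition and decomposition, and are stable under (those existing) pullbacks and pushouts, and moreover $\mathcal N$ is closed under $\mathcal M$-decomposition. An $\mathcal M,\mathcal N$-pushout is a pushout square of an arrow $m\in\mathcal M$ and an arrow $n\in\mathcal N$ with the same domain. Given a preadhesive structure, $\mathbf X$ is $\mathcal M,\mathcal N$-adhesive if pullbacks of arrows of $\mathcal M$ along arbitrary arrows exist, $\mathcal M,\mathcal N$-pushouts exist for all such $m,n$, and each of them is a Van Kampen square: in every commutative cube having it as bottom face, and whose back and left faces (the vertical faces over $m$ and $n$) are pullbacks, the top face is a pushout if and only if the front and right faces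 (the other two vertical faces) are pullbacks. If $f\colon X\to Y$ has a pushout along itself, with coprojections $y_1,y_2\colon Y\rightrightarrows Q_f$, its codiagonal is the unique $\upsilon_f\colon Q_f\to Y$ with $\upsilon_f\circ y_1=\upsilon_f\circ y_2=\mathrm{id}_Y$; an $\mathcal M,\mathcal N$-codiagonal is the codiagonal of an arrow of $\mathcal M\cap\mathcal N$. Suppose that $(\mathcal M,\mathcal N)$ is a preadhesive structure for which $\mathbf X$ is $\mathcal M,\mathcal N$-adhesive, that $\mathcal M\cap\mathcal N$ contains all split monomorphisms, and that $\mathcal N$ contains all $\mathcal M,\mathcal N$-codiagonals. Then there exist a Grothendieck topos $\mathcal E$ (a category equivalent to the category of sheaves of $\mathcal U$-small sets on a $\mathcal U$-small site) and a full and faithful functor $F\colon\mathbf X\to\mathcal E$ which preserves all pullbacks and sends $\mathcal M,\mathcal N$-pushouts to pushouts. -/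

import Mathlib

open CategoryTheory CategoryTheory.Limits

universe w v u

namespace MNAdhesive

section

variable {C : Type u} [Category.{v} C]

/-- The pair `(M, N)` of classes of arrows is a preadhesive structure on `C`. -/
structure IsPreadhesiveStructure (M N : MorphismProperty C) : Prop where
  mono_of_mem : ∀ {X Y : C} (f : X ⟶ Y), M f → Mono f
  left_of_isIso : ∀ {X Y : C} (f : X ⟶ Y), IsIso f → M f
  right_of_isIso : ∀ {X Y : C} (f : X ⟶ Y), IsIso f → N f
  left_comp : M.IsStableUnderComposition
  right_comp : N.IsStableUnderComposition
  /-- `M` is closed under decomposition: `f ≫ g ∈ M` and `g ∈ M` imply `f ∈ M`. -/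
  left_decomp : M.HasOfPostcompProperty M
  /-- `N` is closed under decomposition: `f ≫ g ∈ N` and `g ∈ N` imply `f ∈ N`. -/
  right_decomp : N.HasOfPostcompProperty N
  /-- `N` is closed under `M`-decomposition: `f ≫ g ∈ N` and `g ∈ M` imply `f ∈ N`. -/
  right_decomp_left : N.HasOfPostcompProperty M
  left_pullback : M.IsStableUnderBaseChange
  right_pullback : N.IsStableUnderBaseChange
  left_pushout : M.IsStableUnderCobaseChange
  right_pushout : N.IsStableUnderCobaseChange

/-- `(M, N)` is a preadhesive structure on `C` and `C` is `M, N`-adhesive: pullbacks along arrows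
of `M` exist, pushouts of an arrow of `M` along an arrow of `N` exist, and all of these pushouts are
Van Kampen squares. -/
structure IsAdhesive (M N : MorphismProperty C) : Prop extends IsPreadhesiveStructure M N where
  hasPullback : ∀ {X Y Z : C} (m : X ⟶ Y) (g : Z ⟶ Y), M m → HasPullback m g
  hasPushout : ∀ {X Y Z : C} (m : X ⟶ Y) (n : X ⟶ Z), M m → N n → HasPushout m n
  isVanKampen : ∀ {X Y Z Q : C} {m : X ⟶ Y} {n : X ⟶ Z} {p : Y ⟶ Q} {q : Z ⟶ Q}
    (sq : IsPushout m n p q), M m → N n → sq.IsVanKampen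

/-- `υ` is the codiagonal of `f`, for some choice of the pushout of `f` along itself: it is the
unique arrow whose composites with both coprojections are the identity. -/
def IsCodiagonal {X Y Q : C} (f : X ⟶ Y) (υ : Q ⟶ Y) : Prop :=
  ∃ y₁ y₂ : Y ⟶ Q, IsPushout f f y₁ y₂ ∧ y₁ ≫ υ = 𝟙 Y ∧ y₂ ≫ υ = 𝟙 Y

/-- The class of `M, N`-codiagonals: the codiagonals of the arrows in both `M` and `N`. -/
def codiagonals (M N : MorphismProperty C) : MorphismProperty C :=
  fun _ Y υ => ∃ (X : C) (n : X ⟶ Y), M n ∧ N n ∧ IsCodiagonal n υ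

/-- The class of split monomorphisms. -/
def splitMonos (C : Type u) [Category.{v} C] : MorphismProperty C :=
  fun _ _ f => IsSplitMono f

/-- `F` sends every `M, N`-pushout square to a pushout square. -/
def PreservesPushouts {D : Type*} [Category* D] (M N : MorphismProperty C) (F : C ⥤ D) : Prop :=
  ∀ {X Y Z Q : C} {m : X ⟶ Y} {n : X ⟶ Z} {p : Y ⟶ Q} {q : Z ⟶ Q},
    M m → N n → IsPushout m n p q →
      IsPushout (F.map m) (F.map n) (F.map p) (F.map q)

end

/-- `T` is a Grothendieck topos, relative to the universe `w`: it is equivalent to the category of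
sheaves of `w`-small sets on a `w`-small site. -/
def IsGrothendieckTopos (T : Type u) [Category.{v} T] : Prop :=
  ∃ (S : Type w) (_ : SmallCategory S) (J : GrothendieckTopology S),
    Nonempty (T ≌ Sheaf J (Type w))

end MNAdhesive

/-!
The embedding is the Yoneda embedding into sheaves for the topology in which the two coprojections
`g : B ⟶ E` and `h : D ⟶ E` of every pushout of `m : A ⟶ B` in `M` along `n : A ⟶ D` in `N` cover
`E` (`IsAdhesive.coverage`). The Van Kampen property makes these covers stable under pullback, so a
presheaf is a sheaf as soon as it satisfies descent for each of them.

The sheaves turn out to be the presheaves `P` for which `P E` is the fibre product of `P B` and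
`P D` over `P A` (`IsAdhesive.isSheaf_coverage_iff`). Representable presheaves have this property,
so the topology is subcanonical and the embedding is full, faithful and preserves limits; that
all sheaves have it means, by the Yoneda lemma, that the embedding preserves `M, N`-pushouts
(`isPushout_yoneda_map`).

In one direction the characterization is clear. For the other, let `P` be a sheaf and let `a ∈ P B`
and `b ∈ P D` agree on `A`. Sheaf descent also asks for the two restrictions of `a` to `B ×_E B` to
coincide; over `D ×_E D` there is nothing to check, since `h` is a monomorphism. By
`IsAdhesive.isPushout_diagonal`, `B ×_E B` is the pushout of `m` along the diagonal
`A ⟶ A ×_D A`, and this is again an `M, N`-pushout, because `N` contains split monomorphisms. Hence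
`B ×_E B` is covered by `B`, on which both restrictions are `a`, and by `A ×_D A`, on which both
come from `b`.

To prove `IsAdhesive.isPushout_diagonal`, form the pushout `Q` of `m` along the diagonal of
`A ×_D A` and compare it with `B ×_E B`. Pulling the pushout `E` back along `g` exhibits `B` as the
pushout of `A ×_D A ⟶ B ×_E B` and a projection `A ×_D A ⟶ A`; pasting exhibits `B` as the pushout
of `A ×_D A ⟶ Q` and the same projection. The comparison `Q ⟶ B ×_E B` gives a cube between these
two pushouts, whose back faces are pullbacks by `isPullback_of_isVanKampen`. By the Van Kampen
property the comparison is then a pullback of an identity, hence invertible.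

As `X` is only essentially small, the topology is transported to a small model of `X`; sheaves
correspond under restriction along the equivalence.
-/

namespace MNAdhesive

open Opposite

section

variable {C : Type u} [Category.{v} C] {M N : MorphismProperty C}

/-! ### Kernel pairs of pushouts -/

/-- Let `Q` be a Van Kampen pushout of `m : A ⟶ B` along `d : A ⟶ E` and let `t : Q ⟶ R` restrict to
a monomorphism `k` on `E`. If `A` is the intersection of `E` and `B` over `R`, then `E` is the
pullback of `k` along `t`: by stability that pullback is the pushout of `A` and `E` over `A`. -/
lemma isPullback_of_isVanKampen {A B E Q R : C} {m : A ⟶ B} {d : A ⟶ E} {p : B ⟶ Q} {q : E ⟶ Q}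
    {sq : IsPushout m d p q} (hsq : sq.IsVanKampen) {t : Q ⟶ R} {k : E ⟶ R} [Mono m] [Mono k]
    [HasPullback t k] (hq : q ≫ t = k) (hd : IsPullback d m k (p ≫ t)) :
    IsPullback q (𝟙 E) t k := by
  have W := IsPullback.of_hasPullback t k
  obtain ⟨a, ha₁, ha₂⟩ := W.exists_lift (m ≫ p) d (by simp [hd.w])
  obtain ⟨b, hb₁, hb₂⟩ := W.exists_lift q (𝟙 E) (by simp [hq])
  have ha : IsPullback a m (pullback.fst t k) p :=
    IsPullback.of_right (by simpa only [ha₂] using hd) ha₁ W.flip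
  have hb : IsPullback b (𝟙 E) (pullback.fst t k) q :=
    IsPullback.of_right (by simpa only [hb₂, hq] using IsKernelPair.id_of_mono k)
      (by simp [hb₁]) W.flip
  have top : IsPushout (𝟙 A) d a b :=
    (hsq (𝟙 A) d a b (𝟙 A) m (𝟙 E) (pullback.fst t k) (IsKernelPair.id_of_mono m)
      (IsPullback.of_vert_isIso ⟨by simp⟩) ha.toCommSq hb.toCommSq
      ⟨W.hom_ext (by simp [ha₁, hb₁, sq.w]) (by simp [ha₂, hb₂])⟩).mpr ⟨ha, hb⟩
  have : IsIso b := top.isIso_inr_of_isIso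
  exact W.of_iso (asIso b).symm (Iso.refl _) (Iso.refl _) (Iso.refl _)
    (by simp [hb₁]) (by simpa using IsIso.eq_inv_of_hom_inv_id hb₂) (by simp) (by simp)

/-- For a pullback square, the arrow `k` between the kernel pairs of the parallel arrows `n` and `g`
is a pullback of `m` along the projection. -/
lemma isPullback_kernelPair [HasPullbacks C] {A B D E : C} {m : A ⟶ B} {n : A ⟶ D} {g : B ⟶ E}
    {h : D ⟶ E} (sq : IsPullback m n g h) {k : pullback n n ⟶ pullback g g}
    (hk₁ : k ≫ pullback.fst g g = pullback.fst n n ≫ m)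
    (hk₂ : k ≫ pullback.snd g g = pullback.snd n n ≫ m) :
    IsPullback k (pullback.fst n n) (pullback.fst g g) m := by
  refine IsPullback.of_right ?_ hk₁ (IsPullback.of_hasPullback g g).flip
  rw [hk₂, sq.w]
  exact (IsPullback.of_hasPullback n n).flip.paste_horiz sq

/-- For an `M, N`-pushout of `m` along `n`, the kernel pair of the coprojection `g` opposite `n` is
the union of the diagonal of `B` and the kernel pair of `n`, glued along `A`. -/
theorem IsAdhesive.isPushout_diagonal [HasPullbacks C] (hC : IsAdhesive M N)
    (hsplit : splitMonos C ≤ N) {A B D E : C} {m : A ⟶ B} {n : A ⟶ D} {g : B ⟶ E} {h : D ⟶ E}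
    (sq : IsPushout m n g h) (hm : M m) (hn : N n) :
    ∃ k : pullback n n ⟶ pullback g g, k ≫ pullback.fst g g = pullback.fst n n ≫ m ∧
      k ≫ pullback.snd g g = pullback.snd n n ≫ m ∧
      IsPushout m (pullback.diagonal n) (pullback.diagonal g) k := by
  have := hC.left_pullback
  have := hC.right_pullback
  have := hC.mono_of_mem m hm
  have vk := hC.isVanKampen sq hm hn
  have hsq : IsPullback m n g h := vk.isPullback_of_mono_left
  obtain ⟨k, hk₁, hk₂⟩ := (IsPullback.of_hasPullback g g).exists_lift (pullback.fst n n ≫ m)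
    (pullback.snd n n ≫ m) (by simp [sq.w, pullback.condition_assoc])
  have hk := isPullback_kernelPair hsq hk₁ hk₂
  have hMk : M k := M.of_isPullback hk.flip hm
  have := hC.mono_of_mem k hMk
  have hNsnd : N (pullback.snd n n) := N.of_isPullback (IsPullback.of_hasPullback n n) hn
  -- The pushout `sq`, pulled back along `g`.
  have kp : IsPushout k (pullback.snd n n) (pullback.snd g g) m :=
    (vk k (pullback.snd n n) (pullback.snd g g) m (pullback.fst n n) (pullback.fst g g) n g hk
      (IsPullback.of_hasPullback n n).flip (IsPullback.of_hasPullback g g).flip.toCommSq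
      hsq.toCommSq ⟨hk₂⟩).mpr ⟨(IsPullback.of_hasPullback g g).flip, hsq⟩
  have hdN : N (pullback.diagonal n) := hsplit _ ⟨⟨⟨pullback.fst n n, by simp⟩⟩⟩
  have hd : IsPullback (pullback.diagonal n) m k (pullback.diagonal g) :=
    (IsPullback.of_bot (h₃₁ := m) (v₂₂ := pullback.fst g g)
      (by simpa using IsPullback.of_vert_isIso ⟨by simp⟩) (by ext <;> simp [hk₁, hk₂]) hk).flip
  have := hC.hasPushout m _ hm hdN
  have Q := IsPushout.of_hasPushout m (pullback.diagonal n)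
  obtain ⟨t, ht₁, ht₂⟩ := Q.exists_desc (pullback.diagonal g) k hd.w.symm
  have hQ := isPullback_of_isVanKampen (hC.isVanKampen Q hm hdN) ht₂ (by rwa [ht₁])
  -- The same colimit with `Q` in place of the kernel pair of `g`.
  have kp' : IsPushout (pushout.inr m (pullback.diagonal n)) (pullback.snd n n)
      (t ≫ pullback.snd g g) m := by
    refine (IsPushout.of_top (h₁₁ := m) (v₁₁ := pullback.diagonal n) (v₁₂ := pushout.inl _ _)
      (h₃₁ := m) ?_ ?_ Q)
    · rw [reassoc_of% ht₁]
      simpa using IsPushout.of_vert_isIso ⟨by simp⟩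
    · rw [reassoc_of% ht₂, kp.w]
  have : IsIso t := by
    have := ((hC.isVanKampen kp hMk hNsnd _ _ _ _ (𝟙 _) t (𝟙 _) (𝟙 _) hQ
      (IsPullback.of_vert_isIso ⟨by simp⟩) ⟨by simp⟩ ⟨by simp⟩ kp'.toCommSq).mp kp').1
    exact this.isIso_snd_of_isIso
  refine ⟨k, hk₁, hk₂, ?_⟩
  exact Q.of_iso (Iso.refl _) (Iso.refl _) (Iso.refl _) (asIso t) (by simp) (by simp)
    (by simp [ht₁]) (by simp [ht₂])

/-! ### The topology generated by the pushouts -/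

/-- The object at the source of one of the two coprojections of a pushout; the value `true`
designates the left one. -/
abbrev legObj (B D : C) (b : Bool) : C := bif b then B else D

/-- The two coprojections of a pushout, as a family. -/
def leg {B D E : C} (g : B ⟶ E) (h : D ⟶ E) : ∀ b : Bool, legObj B D b ⟶ E
  | true => g
  | false => h

/-- The coverings generating the topology: the pairs of coprojections of `M, N`-pushouts. They are
stable under pullback by the Van Kampen property. -/
def IsAdhesive.coverage [HasPullbacks C] (hC : IsAdhesive M N) : Coverage C where
  coverings E := {R | ∃ (A B D : C) (m : A ⟶ B) (n : A ⟶ D) (g : B ⟶ E) (h : D ⟶ E),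
    IsPushout m n g h ∧ M m ∧ N n ∧ R = Presieve.ofArrows _ (leg g h)}
  pullback := by
    rintro E E' f _ ⟨A, B, D, m, n, g, h, sq, hm, hn, rfl⟩
    have := hC.left_pullback
    have := hC.right_pullback
    obtain ⟨A', m', n', α, hm', hn', sq'⟩ := (hC.isVanKampen sq hm hn).exists_cube_filling
      (IsPullback.of_hasPullback g f).flip (IsPullback.of_hasPullback h f).flip
    refine ⟨_, ⟨A', _, _, m', n', _, _, sq', M.of_isPullback hm'.flip hm,
      N.of_isPullback hn'.flip hn, rfl⟩, ?_⟩
    rintro _ _ ⟨b⟩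
    cases b
    · exact ⟨_, pullback.fst h f, h, ⟨false⟩, pullback.condition⟩
    · exact ⟨_, pullback.fst g f, g, ⟨true⟩, pullback.condition⟩

/-- A presheaf has this property if it sends every `M, N`-pushout to a pullback of sets. -/
def GluesPushouts (M N : MorphismProperty C) (P : Cᵒᵖ ⥤ Type w) : Prop :=
  ∀ {A B D E : C} {m : A ⟶ B} {n : A ⟶ D} {g : B ⟶ E} {h : D ⟶ E}, IsPushout m n g h → M m → N n →
    ∀ (a : P.obj (op B)) (b : P.obj (op D)), P.map m.op a = P.map n.op b →
      ∃! e : P.obj (op E), P.map g.op e = a ∧ P.map h.op e = b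

/-- Descent for the two coprojections of a single pushout, with compatibility over all objects. -/
lemma isSheafFor_leg_iff (P : Cᵒᵖ ⥤ Type w) {B D E : C} (g : B ⟶ E) (h : D ⟶ E) :
    Presieve.IsSheafFor P (Presieve.ofArrows _ (leg g h)) ↔
      ∀ (a : P.obj (op B)) (b : P.obj (op D)),
        (∀ ⦃Z⦄ (s t : Z ⟶ B), s ≫ g = t ≫ g → P.map s.op a = P.map t.op a) →
        (∀ ⦃Z⦄ (s : Z ⟶ B) (t : Z ⟶ D), s ≫ g = t ≫ h → P.map s.op a = P.map t.op b) →
        (∀ ⦃Z⦄ (s t : Z ⟶ D), s ≫ h = t ≫ h → P.map s.op b = P.map t.op b) →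
        ∃! e : P.obj (op E), P.map g.op e = a ∧ P.map h.op e = b := by
  rw [Presieve.isSheafFor_arrows_iff]
  constructor
  · intro H a b haa hab hbb
    let x : ∀ i, P.obj (op (legObj B D i)) := fun | true => a | false => b
    have hx : Presieve.Arrows.Compatible P (leg g h) x := by
      rintro (_ | _) (_ | _) Z s t hst
      · exact hbb s t hst
      · exact (hab t s hst.symm).symm
      · exact hab s t hst
      · exact haa s t hst
    simpa [leg, x, and_comm] using H x hx
  · intro H x hx
    simpa [leg, and_comm] using H (x true) (x false) (fun Z => hx true true Z)
      (fun Z => hx true false Z) (fun Z => hx false false Z)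

/-- Sheaves are the presheaves that send `M, N`-pushouts to pullbacks. That a sheaf does so rests on
separatedness with respect to the pushout of `IsAdhesive.isPushout_diagonal`. -/
theorem IsAdhesive.isSheaf_coverage_iff [HasPullbacks C] (hC : IsAdhesive M N)
    (hsplit : splitMonos C ≤ N) (P : Cᵒᵖ ⥤ Type w) :
    Presieve.IsSheaf hC.coverage.toGrothendieck P ↔ GluesPushouts M N P := by
  rw [Presieve.isSheaf_coverage]
  constructor
  · intro H A B D E m n g h sq hm hn a b hab
    have := hC.mono_of_mem m hm
    have vk := hC.isVanKampen sq hm hn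
    have := vk.mono_of_mono_left
    refine (isSheafFor_leg_iff P g h).mp (H _ ⟨A, B, D, m, n, g, h, sq, hm, hn, rfl⟩) a b ?_ ?_ ?_
    · -- It suffices to compare the restrictions of `a` along the two projections of the kernel pair.
      suffices hfs : P.map (pullback.fst g g).op a = P.map (pullback.snd g g).op a by
        intro Z s t hst
        have := congrArg (P.map (pullback.lift s t hst).op) hfs
        simpa only [← Functor.map_comp_apply, ← op_comp, pullback.lift_fst,
          pullback.lift_snd] using this
      obtain ⟨k, hk₁, hk₂, dsq⟩ := hC.isPushout_diagonal hsplit sq hm hn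
      have hdN : N (pullback.diagonal n) := hsplit _ ⟨⟨⟨pullback.fst n n, by simp⟩⟩⟩
      have sep := (isSheafFor_leg_iff P _ _).mp (H _ ⟨_, _, _, _, _, _, _, dsq, hm, hdN, rfl⟩)
        (P.map (pullback.diagonal g).op (P.map (pullback.fst g g).op a))
        (P.map k.op (P.map (pullback.fst g g).op a))
      simp only [← Functor.map_comp_apply, ← op_comp] at sep
      refine (sep ?_ ?_ ?_).unique ⟨?_, ?_⟩ ⟨?_, ?_⟩
      · intro Z s t hst
        rw [reassoc_of% hst]
      · intro Z s t hst
        rw [reassoc_of% hst]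
      · intro Z s t hst
        rw [reassoc_of% hst]
      · rw [← Functor.map_comp_apply, ← op_comp]
      · rw [← Functor.map_comp_apply, ← op_comp]
      · rw [← Functor.map_comp_apply, ← op_comp, pullback.diagonal_fst, pullback.diagonal_snd]
      · -- On the kernel pair of `n`, both restrictions of `a` are restrictions of `b`.
        rw [← Functor.map_comp_apply, ← op_comp, hk₁, hk₂]
        simp only [op_comp, Functor.map_comp_apply, hab]
        simp only [← Functor.map_comp_apply, ← op_comp, pullback.condition]
    · intro Z s t hst
      obtain ⟨l, rfl, rfl⟩ := vk.isPullback_of_mono_left.exists_lift s t hst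
      simp [hab]
    · intro Z s t hst
      rw [(cancel_mono h).mp hst]
  · rintro H E _ ⟨A, B, D, m, n, g, h, sq, hm, hn, rfl⟩
    rw [isSheafFor_leg_iff]
    exact fun a b _ hab _ => H sq hm hn a b (hab m n sq.w)

/-! ### The embedding -/

/-- Restriction along a functor that preserves pushouts turns representables into presheaves that
send pushouts to pullbacks. -/
lemma gluesPushouts_comp_yoneda {S : Type*} [Category.{w} S] (F : C ⥤ S)
    [PreservesColimitsOfShape WalkingSpan F] (s : S) :
    GluesPushouts M N (F.op ⋙ yoneda.obj s) := by
  intro A B D E m n g h sq _ _ a b hab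
  have sq' := sq.map F
  refine ⟨sq'.desc a b hab, ⟨sq'.inl_desc _ _ _, sq'.inr_desc _ _ _⟩, ?_⟩
  rintro e ⟨ha, hb⟩
  exact sq'.hom_ext (ha.trans (sq'.inl_desc _ _ _).symm) (hb.trans (sq'.inr_desc _ _ _).symm)

/-- A commutative square in a subcanonical site whose image under every sheaf is a pullback of sets
becomes a pushout of sheaves. -/
lemma isPushout_yoneda_map {S : Type w} [SmallCategory S] (K : GrothendieckTopology S)
    [K.Subcanonical] {A B D E : S} {m : A ⟶ B} {n : A ⟶ D} {g : B ⟶ E} {h : D ⟶ E}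
    (w : m ≫ g = n ≫ h)
    (H : ∀ (G : Sheaf K (Type w)) (a : G.obj.obj (op B)) (b : G.obj.obj (op D)),
      G.obj.map m.op a = G.obj.map n.op b →
        ∃! e : G.obj.obj (op E), G.obj.map g.op e = a ∧ G.obj.map h.op e = b) :
    IsPushout (K.yoneda.map m) (K.yoneda.map n) (K.yoneda.map g) (K.yoneda.map h) := by
  have key : ∀ c : PushoutCocone (K.yoneda.map m) (K.yoneda.map n),
      ∃! l : K.yoneda.obj E ⟶ c.pt, K.yoneda.map g ≫ l = c.inl ∧ K.yoneda.map h ≫ l = c.inr := by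
    intro c
    obtain ⟨e, ⟨ha, hb⟩, he⟩ := H c.pt (K.yonedaEquiv c.inl) (K.yonedaEquiv c.inr)
      (by rw [K.yonedaEquiv_naturality, K.yonedaEquiv_naturality, c.condition])
    refine ⟨K.yonedaEquiv.symm e, ⟨?_, ?_⟩, ?_⟩
    · rw [K.yonedaEquiv_symm_naturality_left, ha, Equiv.symm_apply_apply]
    · rw [K.yonedaEquiv_symm_naturality_left, hb, Equiv.symm_apply_apply]
    · rintro l ⟨hl₁, hl₂⟩
      rw [Equiv.eq_symm_apply]
      exact he _ ⟨by rw [K.yonedaEquiv_naturality, hl₁], by rw [K.yonedaEquiv_naturality, hl₂]⟩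
  choose l hl hl' using key
  exact ⟨⟨by rw [← Functor.map_comp, w, Functor.map_comp]⟩,
    ⟨PushoutCocone.IsColimit.mk _ l (fun c => (hl c).1) (fun c => (hl c).2)
      (fun c k hk₁ hk₂ => hl' c k ⟨hk₁, hk₂⟩)⟩⟩

end

end MNAdhesive

/-- Sizes are measured in the universe `w`. Every category `X : Type u` with homs in `Type v` is
`EssentiallySmall.{w}` for `w = max u v`, by instance, so every category is covered. -/
theorem mainTheorem5 {X : Type u} [Category.{v} X] [EssentiallySmall.{w} X] [HasPullbacks X]
    (M N : MorphismProperty X)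
    (hX : MNAdhesive.IsAdhesive M N)
    (hsplit : MNAdhesive.splitMonos X ≤ M ⊓ N)
    (hcodiag : MNAdhesive.codiagonals M N ≤ N) :
    ∃ (T : Type (w + 1)) (_ : Category.{w} T) (F : X ⥤ T),
      MNAdhesive.IsGrothendieckTopos.{w} T ∧
      F.Full ∧ F.Faithful ∧
      PreservesLimitsOfShape WalkingCospan F ∧
      MNAdhesive.PreservesPushouts M N F := by
  have hsplitN : MNAdhesive.splitMonos X ≤ N := hsplit.trans inf_le_right
  let e := equivSmallModel.{w} X
  let J := hX.coverage.toGrothendieck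
  let K := e.inverse.inducedTopology J
  have hK : K.Subcanonical := .of_isSheaf_yoneda_obj K fun s => by
    have hJ := (hX.isSheaf_coverage_iff hsplitN _).mpr
      (MNAdhesive.gluesPushouts_comp_yoneda e.functor s)
    exact Presieve.isSheaf_iso K
      ((Functor.associator _ _ _).symm ≪≫ Functor.isoWhiskerRight e.op.counitIso (yoneda.obj s) ≪≫
        Functor.leftUnitor _)
      (e.inverse.op_comp_isSheaf_of_isSheaf_type K hJ)
  refine ⟨Sheaf K (Type w), inferInstance, e.functor ⋙ K.yoneda,
    ⟨_, inferInstance, K, ⟨.refl⟩⟩, inferInstance, inferInstance, inferInstance, ?_⟩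
  intro A B D E m n g h hm hn sq
  refine MNAdhesive.isPushout_yoneda_map K (by simp only [← Functor.map_comp, sq.w]) fun G => ?_
  exact (hX.isSheaf_coverage_iff hsplitN _).mp
    (e.functor.op_comp_isSheaf_of_types J K G) sq hm hn
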